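/- Let $R$ be a commutative ring and let $H$ be a Hopf algebra over $R$, with counit $\varepsilon$ and antipode $\mathcal S$, that is finitely generated projective as an $R$-module, separable as an $R$-algebra (i.e. projective as an $H\otimes_R H^{\mathrm{op}}$-module) and involutory ($\mathcal S^2=\mathrm{Id}$). Let $H^\vee=\operatorname{Hom}_R(H,R)$ be the dual algebra, with convolution product and counit $f\mapsto\langle f,1\rangle$. Let $\Lambda\in H$ be a right integral ($\Lambda a=\langle\varepsilon,a\rangle\Lambda$ for all $a\in H$) and $\lambda\in H^\vee$ a left integral ($f\lambda=\langle f,1\rangle\lambda$ for all $f\in H^\vee$) such that $\langle\lambda,\Lambda\rangle=1$, and put $\beta(a,b)=\langle\lambda,ab\rangle$ for $a,b\in H$. For a left $H$-module $M$ that is finitely generated projective over $R$, let $\operatorname{Tr}\colon\operatorname{End}_R(M)\cong M\otimes_R M^\vee\to R$ be the trace, $\operatorname{rank}_R M=\operatorname{Tr}(1_M)\in R$ the Hattori–Stallings rank, and $\chi_M\in H^\vee$, $\chi_M(a)=\operatorname{Tr}(m\mapsto am)$, the character of $M$; let $\chi_{\mathrm{reg}}=\chi_H$ be the regular character. For a trace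 form $\mu\in H^\vee$ let $\boldsymbol b_\mu\colon H\to H^\vee$ be the map $a\mapsto\langle\mu,a\,\cdot\,\rangle=\langle\mu,\,\cdot\,a\rangle$. Let $M$ be a cyclic left $H$-module that is finitely generated projective over $R$ and satisfies $\operatorname{End}_H(M)\cong R$ as $R$-algebras, and let $\omega_M\colon\mathcal Z(H)\to R$ be its central character: $x\in\mathcal Z(H)$ acts on $M$ as the scalar $\omega_M(x)$. Then the form $\beta$ is nonsingular and symmetric, the unique element $z(M)\in H$ with $\chi_M=\beta(\,\cdot\,,z(M))$ lies in the center $\mathcal Z(H)$, and, with $[H:M]_\beta:=\omega_M(z(M))\in R$: (a) $\operatorname{rank}_R M$ is invertible in $R$; (b) $[H:M]_\beta=\langle\varepsilon,\Lambda\rangle(\operatorname{rank}_R M)^{-1}$, and this element is invertible in $R$; (c) the element $e(M):=[H:M]_\beta^{-1}z(M)$ is a central idempotent of $H$ satisfying $\boldsymbol b_\lambda(e(M))=[H:M]_\beta^{-1}\chi_M$ and $\boldsymbol b_{\chi_{\mathrm{reg}}}(e(M))=(\operatorname{rank}_R M)\,\chi_M$ (in particular the latter is the formula for $\boldsymbol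 b_\lambda(e(M))$ when $\lambda=\chi_{\mathrm{reg}}$). -/

import Mathlib

open scoped TensorProduct

noncomputable section

/-! ### Algebras over a commutative ring -/

/-- An `R`-algebra `A` is separable if `A`, with the action `(a ⊗ b) • x = a * x * b`, is a
projective module over the enveloping algebra `A ⊗ Aᵒᵖ`. -/
def IsSeparableAlgebra (R A : Type*) [CommRing R] [Ring A] [Algebra R A] : Prop :=
  letI : Module (A ⊗[R] Aᵐᵒᵖ) A := TensorProduct.Algebra.module
  Module.Projective (A ⊗[R] Aᵐᵒᵖ) A

/-- The trace `Tr : End_R(M) ≅ M^∨ ⊗ M → R` of a finitely generated projective module, given by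
evaluation of `M^∨` on `M`. (Mathlib's `LinearMap.trace` is only meaningful for free modules.) -/
def projTrace (R M : Type*) [CommRing R] [AddCommGroup M] [Module R M] [Module.Finite R M]
    [Module.Projective R M] : Module.End R M →ₗ[R] R :=
  contractLeft R M ∘ₗ (dualTensorHomEquiv R M M).symm.toLinearMap

/-- The Hattori-Stallings rank `Tr(1_M) ∈ R` of a finitely generated projective module. -/
def hsRank (R M : Type*) [CommRing R] [AddCommGroup M] [Module R M] [Module.Finite R M]
    [Module.Projective R M] : R :=
  projTrace R M LinearMap.id

/-- The character `χ_M(a) = Tr(m ↦ a • m)` of an `A`-module `M` that is finitely generated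
projective over `R`. -/
def moduleCharacter (R A M : Type*) [CommRing R] [Ring A] [Algebra R A] [AddCommGroup M]
    [Module R M] [Module A M] [IsScalarTower R A M] [Module.Finite R M] [Module.Projective R M] :
    Module.Dual R A :=
  projTrace R M ∘ₗ (Algebra.lsmul R R M : A →ₐ[R] Module.End R M).toLinearMap

/-- The regular character `χ_reg(a) = Tr(x ↦ a * x)`. -/
def regularCharacter (R A : Type*) [CommRing R] [Ring A] [Algebra R A] [Module.Finite R A]
    [Module.Projective R A] : Module.Dual R A :=
  moduleCharacter R A A

/-- The bilinear form `β(a, b) = ⟨l, a * b⟩` attached to a linear form `l`. As a map `A → A^∨` it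
is `a ↦ (c ↦ ⟨l, a * c⟩)`. -/
def formOf {R A : Type*} [CommRing R] [Ring A] [Algebra R A] (l : Module.Dual R A) :
    A →ₗ[R] A →ₗ[R] R :=
  (LinearMap.mul R A).compr₂ l

/-- For a nonsingular form `β`, the element `z(M) ∈ A` with `χ_M = β( · , z(M))`. -/
def characterElement {R A : Type*} (M : Type*) [CommRing R] [Ring A] [Algebra R A]
    [AddCommGroup M] [Module R M] [Module A M] [IsScalarTower R A M] [Module.Finite R M]
    [Module.Projective R M] (β : A →ₗ[R] A →ₗ[R] R) [β.IsPerfPair] : A :=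
  β.flip.toPerfPair.symm (moduleCharacter R A M)

/-- The action of the center of `A` on an `A`-module `M` by `A`-linear maps `m ↦ x • m`. -/
def centerToEnd (R A M : Type*) [CommRing R] [Ring A] [Algebra R A] [AddCommGroup M]
    [Module R M] [Module A M] [IsScalarTower R A M] :
    Subalgebra.center R A →ₐ[R] Module.End A M where
  toFun x :=
    { toFun := fun m => (x : A) • m
      map_add' := fun m n => smul_add _ m n
      map_smul' := fun a m => by
        have h : a * (x : A) = (x : A) * a := Subalgebra.mem_center_iff.mp x.2 a
        simp only [RingHom.id_apply, smul_smul, h] }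
  map_one' := by ext m; exact one_smul A m
  map_mul' x y := by ext m; exact mul_smul (x : A) (y : A) m
  map_zero' := by ext m; exact zero_smul A m
  map_add' x y := by ext m; exact add_smul (x : A) (y : A) m
  commutes' r := by ext m; exact algebraMap_smul A r m

/-- The central character `ω_M : Z(A) → R` of an `A`-module `M` with `End_A(M) ≅ R`. -/
def centralCharacter {R A M : Type*} [CommRing R] [Ring A] [Algebra R A] [AddCommGroup M]
    [Module R M] [Module A M] [IsScalarTower R A M] (φ : Module.End A M ≃ₐ[R] R) :
    Subalgebra.center R A →ₐ[R] R :=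
  (φ : Module.End A M →ₐ[R] R).comp (centerToEnd R A M)

/-- The index `[A : M]_β = ω_M(z(M))`. -/
def moduleIndex {R A M : Type*} [CommRing R] [Ring A] [Algebra R A]
    [AddCommGroup M] [Module R M] [Module A M] [IsScalarTower R A M] [Module.Finite R M]
    [Module.Projective R M] (φ : Module.End A M ≃ₐ[R] R) (β : A →ₗ[R] A →ₗ[R] R) [β.IsPerfPair]
    (hz : characterElement M β ∈ Subalgebra.center R A) : R :=
  centralCharacter φ ⟨characterElement M β, hz⟩

/-- The element `e(M) = [A : M]_β⁻¹ z(M)` of the center of `A`; it has its meaning when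
`[A : M]_β` is a unit of `R`. -/
def moduleIdempotent {R A M : Type*} [CommRing R] [Ring A] [Algebra R A]
    [AddCommGroup M] [Module R M] [Module A M] [IsScalarTower R A M] [Module.Finite R M]
    [Module.Projective R M] (φ : Module.End A M ≃ₐ[R] R) (β : A →ₗ[R] A →ₗ[R] R) [β.IsPerfPair]
    (hz : characterElement M β ∈ Subalgebra.center R A) : Subalgebra.center R A :=
  Ring.inverse (moduleIndex φ β hz) • ⟨characterElement M β, hz⟩

/-! ### Integrals -/

/-- Right integrals of an algebra `A` with respect to an augmentation `ε`. -/
def rightIntegrals {R A : Type*} [CommRing R] [Ring A] [Algebra R A] (ε : A →ₗ[R] R) :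
    Submodule R A where
  carrier := {t | ∀ a : A, t * a = ε a • t}
  add_mem' := fun {s t} hs ht a => by rw [add_mul, hs a, ht a, smul_add]
  zero_mem' := fun a => by rw [zero_mul, smul_zero]
  smul_mem' := fun r t ht a => by rw [smul_mul_assoc, ht a, smul_comm]

/-- Left integrals of an algebra `A` with respect to an augmentation `ε`. -/
def leftIntegrals {R A : Type*} [CommRing R] [Ring A] [Algebra R A] (ε : A →ₗ[R] R) :
    Submodule R A where
  carrier := {t | ∀ a : A, a * t = ε a • t}
  add_mem' := fun {s t} hs ht a => by rw [mul_add, hs a, ht a, smul_add]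
  zero_mem' := fun a => by rw [mul_zero, smul_zero]
  smul_mem' := fun r t ht a => by rw [mul_smul_comm, ht a, smul_comm]

/-- The counit `f ↦ ⟨f, 1⟩` of the dual Hopf algebra `H^∨`, whose multiplication is convolution. -/
def dualCounit (R H : Type*) [CommRing R] [Ring H] [HopfAlgebra R H] :
    WithConv (Module.Dual R H) →ₗ[R] R where
  toFun f := f.ofConv 1
  map_add' _ _ := rfl
  map_smul' _ _ := rfl

/-- A Hopf algebra is involutory if its antipode squares to the identity. -/
def IsInvolutory (R H : Type*) [CommRing R] [Ring H] [HopfAlgebra R H] : Prop :=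
  ∀ a : H, HopfAlgebra.antipode R (HopfAlgebra.antipode R a) = a

end

/-! ### Traces over a finitely generated projective module. -/

section Trace

variable {R M : Type*} [CommRing R] [AddCommGroup M] [Module R M] [Module.Finite R M]
  [Module.Projective R M]

/-! Separability gives a left integral `t` with `ε t = 1`, so `Λ = ε(Λ) t`. Hence `Λ` is a two-sided
integral, `1 = l Λ = ε(Λ) l(t)` makes `ε(Λ)` a unit, and involutivity gives `S Λ = Λ`. It follows
that `S(Λ₁)` and `Λ₂` are dual bases for `β`, that `β` is symmetric, and that `∑ S(Λ₁) Λ₂ = ε(Λ) 1`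
(`isDualBasisPair_of_integrals`, `apply_mul_comm_of_integrals`).

The rest holds for any symmetric form with dual bases `x`, `y` and `∑ xᵢ yᵢ = u • 1`. Since
`End_A(M)` is `R`, averaging over the dual bases yields Schur orthogonality, in particular `∑
χ_M(xᵢ) χ_M(yᵢ) = u`. As `z(M) = ∑ χ_M(xᵢ) yᵢ` acts on `M` by the index, `χ_M(z(M))` equals both `u`
and index times rank (`moduleIndex_mul_hsRank`). For `u = ε(Λ)` both factors are therefore units,
and (c) follows from `z² = index • z` and `χ_reg = u • l`. -/

theorem projTrace_dualTensorHom (t : Module.Dual R M ⊗[R] M) :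
    projTrace R M (dualTensorHom R M M t) = contractLeft R M t :=
  congrArg (contractLeft R M) ((dualTensorHomEquiv R M M).symm_apply_apply t)

theorem projTrace_dualTensorHom_tmul (p : Module.Dual R M) (m : M) :
    projTrace R M (dualTensorHom R M M (p ⊗ₜ m)) = p m := by
  rw [projTrace_dualTensorHom, contractLeft_apply]

/-- Endomorphisms of a finitely generated projective module are sums of endomorphisms of
rank one. -/
theorem end_induction_of_projective {P : Module.End R M → Prop} (f : Module.End R M)
    (h0 : P 0) (h1 : ∀ (p : Module.Dual R M) (m : M), P (dualTensorHom R M M (p ⊗ₜ m)))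
    (hadd : ∀ f g, P f → P g → P (f + g)) : P f := by
  obtain ⟨t, rfl⟩ := (dualTensorHom_bijective (R := R) (M := M) (N := M)).2 f
  induction t with
  | zero => simpa using h0
  | tmul p m => exact h1 p m
  | add a b ha hb => simpa using hadd _ _ ha hb

/-- For `f = p ⊗ m` both sides are `p (g m)`; additivity in `f` does the rest. -/
theorem projTrace_mul_comm (f g : Module.End R M) :
    projTrace R M (f * g) = projTrace R M (g * f) := by
  induction f using end_induction_of_projective with
  | h0 => simp
  | h1 p m =>
    have h₁ : dualTensorHom R M M (p ⊗ₜ m) * g = dualTensorHom R M M ((p ∘ₗ g) ⊗ₜ m) := by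
      ext; simp
    have h₂ : g * dualTensorHom R M M (p ⊗ₜ m) = dualTensorHom R M M (p ⊗ₜ g m) := by
      ext; simp
    rw [h₁, h₂, projTrace_dualTensorHom_tmul, projTrace_dualTensorHom_tmul]
    rfl
  | hadd f₁ f₂ h₁ h₂ => rw [add_mul, mul_add, map_add, map_add, h₁, h₂]

end Trace

/-! ### Characters and Schur's lemma. -/

section Character

variable {R A M : Type*} [CommRing R] [Ring A] [Algebra R A] [AddCommGroup M]
  [Module R M] [Module A M] [IsScalarTower R A M] [Module.Finite R M] [Module.Projective R M]

theorem moduleCharacter_apply (a : A) :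
    moduleCharacter R A M a = projTrace R M (Algebra.lsmul R R M a) := rfl

theorem moduleCharacter_mul_comm (a b : A) :
    moduleCharacter R A M (a * b) = moduleCharacter R A M (b * a) := by
  simp only [moduleCharacter_apply, map_mul]
  exact projTrace_mul_comm _ _

theorem moduleCharacter_eq_of_smul_eq {a b : A} {r : R} (h : ∀ m : M, a • m = r • b • m) :
    moduleCharacter R A M a = r * moduleCharacter R A M b := by
  have : (Algebra.lsmul R R M a : Module.End R M) = r • Algebra.lsmul R R M b := by
    ext m; simpa using h m
  rw [moduleCharacter_apply, this, map_smul, smul_eq_mul, moduleCharacter_apply]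

theorem moduleCharacter_one : moduleCharacter R A M 1 = hsRank R M := by
  rw [moduleCharacter_apply, map_one]; rfl

omit [Module.Finite R M] [Module.Projective R M] in
theorem end_apply_eq_smul (φ : Module.End A M ≃ₐ[R] R) (f : Module.End A M) (m : M) :
    f m = φ f • m := by
  have : f = algebraMap R (Module.End A M) (φ f) := by
    apply φ.injective
    rw [AlgEquiv.commutes]
    rfl
  conv_lhs => rw [this]
  rfl

omit [Module.Finite R M] [Module.Projective R M] in
theorem centralCharacter_smul (φ : Module.End A M ≃ₐ[R] R) (x : Subalgebra.center R A) (m : M) :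
    centralCharacter φ x • m = (x : A) • m :=
  (end_apply_eq_smul φ (centerToEnd R A M x) m).symm

end Character

/-! ### Dual bases for the form attached to a linear form -/

/-- Finite families `x`, `y` which are dual bases for the form `(a, b) ↦ l (a * b)`. -/
structure IsDualBasisPair {R A ι : Type*} [CommRing R] [Ring A] [Algebra R A] [Fintype ι]
    (l : Module.Dual R A) (x y : ι → A) : Prop where
  left : ∀ a, ∑ i, l (y i * a) • x i = a
  right : ∀ a, ∑ i, l (a * x i) • y i = a

namespace IsDualBasisPair

variable {R A ι : Type*} [CommRing R] [Ring A] [Algebra R A] [Fintype ι]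
  {l : Module.Dual R A} {x y : ι → A}

theorem isPerfPair (h : IsDualBasisPair l x y) : (formOf l).IsPerfPair where
  bijective_left := by
    refine ⟨fun a b hab => ?_, fun f => ⟨∑ i, f (x i) • y i, ?_⟩⟩
    · rw [← h.right a, ← h.right b]
      exact Finset.sum_congr rfl fun i _ => congrArg (· • y i) (LinearMap.congr_fun hab (x i))
    · ext c
      conv_rhs => rw [← h.left c]
      simp [formOf, mul_comm]
  bijective_right := by
    refine ⟨fun a b hab => ?_, fun f => ⟨∑ i, f (y i) • x i, ?_⟩⟩
    · rw [← h.left a, ← h.left b]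
      exact Finset.sum_congr rfl fun i _ => congrArg (· • x i) (LinearMap.congr_fun hab (y i))
    · ext c
      conv_rhs => rw [← h.right c]
      simp [formOf, mul_comm]

/-- Expand `a * x i` in the `x j`, move the coefficients across the tensor sign, and recollect `y j
* a`. -/
theorem casimir (h : IsDualBasisPair l x y) (a : A) :
    ∑ i, (a * x i) ⊗ₜ[R] y i = ∑ i, x i ⊗ₜ[R] (y i * a) := by
  have h₁ : ∀ i, (a * x i) ⊗ₜ[R] y i = ∑ j, x j ⊗ₜ[R] (l (y j * a * x i) • y i) := fun i => by
    conv_lhs => rw [← h.left (a * x i)]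
    simp [TensorProduct.sum_tmul, TensorProduct.smul_tmul, mul_assoc]
  simp_rw [h₁]
  rw [Finset.sum_comm]
  simp_rw [← TensorProduct.tmul_sum, h.right]

section Module

variable {M : Type*} [AddCommGroup M] [Module R M] [Module A M] [IsScalarTower R A M]

/-- The `A`-linear map `m ↦ ∑ xᵢ f(yᵢ m)` attached to an `R`-linear endomorphism `f`. -/
def average (h : IsDualBasisPair l x y) (f : Module.End R M) : Module.End A M where
  toFun m := ∑ i, x i • f (y i • m)
  map_add' m n := by simp [Finset.sum_add_distrib]
  map_smul' a m := by
    -- Linearity is the image of the Casimir identity under `u ⊗ v ↦ u • f (v • m)`.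
    have := congrArg (TensorProduct.lift (LinearMap.mk₂ R (fun u v : A => u • f (v • m))
      (fun _ _ _ => add_smul _ _ _) (fun _ _ _ => smul_assoc _ _ _)
      (fun _ _ _ => by rw [add_smul, map_add, smul_add])
      (fun r u v => by rw [smul_assoc, map_smul, smul_comm]))) (h.casimir a)
    simpa [mul_smul, Finset.smul_sum] using this.symm

theorem average_apply (h : IsDualBasisPair l x y) (f : Module.End R M) (m : M) :
    h.average f m = ∑ i, x i • f (y i • m) := rfl

theorem average_zero (h : IsDualBasisPair l x y) :
    h.average (0 : Module.End R M) = 0 := by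
  ext m; simp [average_apply]

theorem average_add (h : IsDualBasisPair l x y) (f g : Module.End R M) :
    h.average (f + g) = h.average f + h.average g := by
  ext m; simp [average_apply, Finset.sum_add_distrib]

theorem average_smul (h : IsDualBasisPair l x y) (r : R) (f : Module.End R M) :
    h.average (r • f) = r • h.average f := by
  ext m; simp [average_apply, Finset.smul_sum, smul_comm r]

theorem average_one (h : IsDualBasisPair l x y) {u : R} (hu : ∑ i, x i * y i = u • 1) :
    h.average (1 : Module.End R M) = u • 1 := by
  ext m
  have := congrArg (· • m) hu
  simpa [average_apply, Finset.sum_smul, mul_smul] using this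

variable [Module.Finite R M] [Module.Projective R M]

/-- Schur orthogonality. For `f = p ⊗ m` and `g = q ⊗ n` the sum is `p` applied to the average of `q
⊗ m` at `n`; that average is a scalar, and `f * g = p n • (q ⊗ m)`. -/
theorem sum_projTrace_mul_projTrace (h : IsDualBasisPair l x y) (φ : Module.End A M ≃ₐ[R] R)
    (f g : Module.End R M) :
    ∑ i, projTrace R M (Algebra.lsmul R R M (x i) * f) *
      projTrace R M (Algebra.lsmul R R M (y i) * g) = φ (h.average (f * g)) := by
  induction f using end_induction_of_projective with
  | h0 => simp [average_zero]
  | hadd f₁ f₂ h₁ h₂ => simp [mul_add, add_mul, Finset.sum_add_distrib, h₁, h₂, average_add]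
  | h1 p m =>
    induction g using end_induction_of_projective with
    | h0 => simp [average_zero]
    | hadd g₁ g₂ h₁ h₂ => simp [mul_add, Finset.sum_add_distrib, h₁, h₂, average_add]
    | h1 q n =>
      have hr (a : A) (p : Module.Dual R M) (m : M) :
          Algebra.lsmul R R M a * dualTensorHom R M M (p ⊗ₜ m) =
            dualTensorHom R M M (p ⊗ₜ (a • m)) := by ext; simp
      have hpq : dualTensorHom R M M (p ⊗ₜ m) * dualTensorHom R M M (q ⊗ₜ n) =
          p n • dualTensorHom R M M (q ⊗ₜ m) := by
        ext; simp [smul_smul, mul_comm]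
      have hav := congrArg p (end_apply_eq_smul φ (h.average (dualTensorHom R M M (q ⊗ₜ m))) n)
      rw [hpq, average_smul, map_smul, smul_eq_mul, mul_comm]
      rw [map_smul, smul_eq_mul] at hav
      rw [← hav, average_apply, map_sum]
      refine Finset.sum_congr rfl fun i _ => ?_
      rw [hr, hr, projTrace_dualTensorHom_tmul, projTrace_dualTensorHom_tmul]
      simp [smul_comm (x i), mul_comm]

theorem sum_moduleCharacter_mul (h : IsDualBasisPair l x y) (φ : Module.End A M ≃ₐ[R] R)
    {u : R} (hu : ∑ i, x i * y i = u • 1) :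
    ∑ i, moduleCharacter R A M (x i) * moduleCharacter R A M (y i) = u := by
  have := h.sum_projTrace_mul_projTrace φ 1 1
  rw [mul_one, h.average_one hu, map_smul, map_one, smul_eq_mul, mul_one] at this
  simpa only [mul_one, ← moduleCharacter_apply] using this

/-- Left multiplication by `a` is `∑ l(yᵢ ·) ⊗ a xᵢ`, with trace `∑ l(yᵢ a xᵢ) = l(a ∑ xᵢ yᵢ)`. -/
theorem regularCharacter_eq [Module.Finite R A] [Module.Projective R A]
    (h : IsDualBasisPair l x y) (hl : ∀ a b, l (a * b) = l (b * a)) {u : R}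
    (hu : ∑ i, x i * y i = u • 1) : regularCharacter R A = u • l := by
  ext a
  have ha : (Algebra.lsmul R R A a : Module.End R A) =
      ∑ i, dualTensorHom R A A ((l ∘ₗ LinearMap.mulLeft R (y i)) ⊗ₜ (a * x i)) := by
    ext b
    conv_lhs => rw [← h.left b]
    simp
  rw [regularCharacter, moduleCharacter_apply, ha, map_sum]
  simp_rw [projTrace_dualTensorHom_tmul]
  calc ∑ i, l (y i * (a * x i)) = l (a * ∑ i, x i * y i) := by
        rw [Finset.mul_sum, map_sum]
        exact Finset.sum_congr rfl fun i _ => by rw [hl, mul_assoc]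
    _ = (u • l) a := by simp [hu]

end Module

end IsDualBasisPair

/-! ### The element `z(M)`, the index and the idempotent. -/

section CharacterElement

variable {R A M : Type*} [CommRing R] [Ring A] [Algebra R A] [AddCommGroup M]
  [Module R M] [Module A M] [IsScalarTower R A M] [Module.Finite R M] [Module.Projective R M]
  {l : Module.Dual R A} [(formOf l).IsPerfPair]

theorem apply_mul_characterElement (a : A) :
    l (a * characterElement M (formOf l)) = moduleCharacter R A M a :=
  LinearMap.congr_fun ((formOf l).flip.toPerfPair.apply_symm_apply (moduleCharacter R A M)) a

theorem eq_of_apply_mul_eq {a b : A} (h : ∀ c, l (c * a) = l (c * b)) : a = b :=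
  (LinearMap.IsPerfPair.bijective_right (formOf l)).1 (LinearMap.ext h)

theorem characterElement_mem_center (hl : ∀ a b, l (a * b) = l (b * a)) :
    characterElement M (formOf l) ∈ Subalgebra.center R A := by
  refine Subalgebra.mem_center_iff.mpr fun b => eq_of_apply_mul_eq (l := l) fun a => ?_
  rw [← mul_assoc, apply_mul_characterElement, moduleCharacter_mul_comm,
    ← apply_mul_characterElement (l := l), mul_assoc, hl, mul_assoc]

theorem characterElement_smul (φ : Module.End A M ≃ₐ[R] R)
    (hz : characterElement M (formOf l) ∈ Subalgebra.center R A) (m : M) :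
    characterElement M (formOf l) • m = moduleIndex φ (formOf l) hz • m :=
  (centralCharacter_smul φ ⟨_, hz⟩ m).symm

theorem moduleCharacter_mul_characterElement (φ : Module.End A M ≃ₐ[R] R)
    (hz : characterElement M (formOf l) ∈ Subalgebra.center R A) (a : A) :
    moduleCharacter R A M (a * characterElement M (formOf l)) =
      moduleIndex φ (formOf l) hz * moduleCharacter R A M a :=
  moduleCharacter_eq_of_smul_eq fun m => by
    rw [mul_smul, characterElement_smul φ hz, smul_algebra_smul_comm]

theorem characterElement_mul_self (φ : Module.End A M ≃ₐ[R] R)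
    (hz : characterElement M (formOf l) ∈ Subalgebra.center R A) :
    characterElement M (formOf l) * characterElement M (formOf l) =
      moduleIndex φ (formOf l) hz • characterElement M (formOf l) := by
  refine eq_of_apply_mul_eq (l := l) fun a => ?_
  rw [← mul_assoc, apply_mul_characterElement, moduleCharacter_mul_characterElement φ hz,
    mul_smul_comm, map_smul, apply_mul_characterElement, smul_eq_mul]

/-- Two evaluations of `χ_M(z)`: `z` acts on `M` as the index, and `z = ∑ χ_M(xᵢ) yᵢ`. -/
theorem moduleIndex_mul_hsRank {ι : Type*} [Fintype ι] {x y : ι → A}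
    (h : IsDualBasisPair l x y) (hl : ∀ a b, l (a * b) = l (b * a)) (φ : Module.End A M ≃ₐ[R] R)
    (hz : characterElement M (formOf l) ∈ Subalgebra.center R A) {u : R}
    (hu : ∑ i, x i * y i = u • 1) :
    moduleIndex φ (formOf l) hz * hsRank R M = u := by
  have hχ := moduleCharacter_mul_characterElement φ hz 1
  rw [one_mul, moduleCharacter_one] at hχ
  rw [← hχ, ← h.right (characterElement M (formOf l)), map_sum]
  refine Eq.trans (Finset.sum_congr rfl fun i _ => ?_) (h.sum_moduleCharacter_mul φ hu)
  rw [hl, apply_mul_characterElement, map_smul, smul_eq_mul]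

theorem isIdempotentElem_moduleIdempotent (φ : Module.End A M ≃ₐ[R] R)
    (hz : characterElement M (formOf l) ∈ Subalgebra.center R A)
    (hi : IsUnit (moduleIndex φ (formOf l) hz)) :
    IsIdempotentElem (moduleIdempotent φ (formOf l) hz) := by
  apply Subtype.ext
  simp only [moduleIdempotent, MulMemClass.coe_mul, SetLike.val_smul, smul_mul_smul_comm]
  rw [characterElement_mul_self φ hz, smul_smul, mul_assoc, Ring.inverse_mul_cancel _ hi, mul_one]

theorem formOf_moduleIdempotent (hl : ∀ a b, l (a * b) = l (b * a))
    (φ : Module.End A M ≃ₐ[R] R) (hz : characterElement M (formOf l) ∈ Subalgebra.center R A) :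
    formOf l (moduleIdempotent φ (formOf l) hz : A) =
      Ring.inverse (moduleIndex φ (formOf l) hz) • moduleCharacter R A M := by
  ext a
  rw [LinearMap.smul_apply, ← apply_mul_characterElement (l := l), hl]
  simp [formOf, moduleIdempotent]

end CharacterElement

/-- A separable algebra with augmentation `ε` has a left integral `t` with `ε t = 1`. -/
theorem IsSeparableAlgebra.exists_leftIntegral {R A : Type*} [CommRing R] [Ring A] [Algebra R A]
    (h : IsSeparableAlgebra R A) (ε : A →ₐ[R] R) :
    ∃ t ∈ leftIntegrals ε.toLinearMap, ε t = 1 := by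
  let : Module (A ⊗[R] Aᵐᵒᵖ) A := TensorProduct.Algebra.module
  have : Module.Projective (A ⊗[R] Aᵐᵒᵖ) A := h
  have hsmul (a : A) (b : Aᵐᵒᵖ) (c : A) : (a ⊗ₜ[R] b) • c = a * (c * b.unop) := rfl
  -- `σ` splits `w ↦ w • 1`, so `σ 1` is a separability idempotent; applying `ε` to its second leg
  -- (the map `ψ`) gives the integral.
  obtain ⟨σ, hσ⟩ := Module.projective_lifting_property
    (LinearMap.toSpanSingleton (A ⊗[R] Aᵐᵒᵖ) A 1) LinearMap.id fun a =>
      ⟨a ⊗ₜ 1, by simp [hsmul]⟩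
  let ψ : A ⊗[R] Aᵐᵒᵖ →ₗ[R] A := TensorProduct.lift
    (LinearMap.mk₂ R (fun (a : A) (b : Aᵐᵒᵖ) => ε b.unop • a)
      (fun _ _ _ => smul_add _ _ _) (fun _ _ _ => smul_comm _ _ _)
      (fun _ _ _ => by simp [add_smul]) (fun _ _ _ => by simp [smul_smul]))
  have hψ (a : A) (b : Aᵐᵒᵖ) : ψ (a ⊗ₜ b) = ε b.unop • a := rfl
  have hl (a : A) (w : A ⊗[R] Aᵐᵒᵖ) : ψ ((a ⊗ₜ 1) * w) = a * ψ w := by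
    induction w with
    | zero => simp
    | tmul b c => simp [hψ]
    | add v w hv hw => simp only [mul_add, map_add, hv, hw]
  have hr (a : A) (w : A ⊗[R] Aᵐᵒᵖ) : ψ ((1 ⊗ₜ MulOpposite.op a) * w) = ε a • ψ w := by
    induction w with
    | zero => simp
    | tmul b c => simp [hψ, smul_smul, mul_comm]
    | add v w hv hw => simp only [mul_add, map_add, smul_add, hv, hw]
  have hε (w : A ⊗[R] Aᵐᵒᵖ) : ε (ψ w) = ε (w • (1 : A)) := by
    induction w with
    | zero =>
      rw [map_zero, map_zero]
      exact ((congrArg ε (zero_smul (A ⊗[R] Aᵐᵒᵖ) (1 : A))).trans (map_zero ε)).symm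
    | tmul b c => simp [hψ, hsmul, mul_comm]
    | add v w hv hw => simp only [map_add, add_smul, hv, hw]
  refine ⟨ψ (σ 1), fun a => ?_, ?_⟩
  · have : ((a ⊗ₜ 1 : A ⊗[R] Aᵐᵒᵖ)) * σ 1 = (1 ⊗ₜ MulOpposite.op a) * σ 1 := by
      rw [← smul_eq_mul, ← smul_eq_mul, ← map_smul, ← map_smul, hsmul, hsmul]
      simp
    rw [← hl, this, hr]
    rfl
  · have : (σ 1) • (1 : A) = 1 := LinearMap.congr_fun hσ 1
    rw [hε, this, map_one]

/-! ### Convolution identities in `Hom(H, H ⊗ H)`, and integrals. -/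

section Hopf

open Coalgebra HopfAlgebra WithConv

variable {R H : Type*} [CommRing R] [Ring H] [HopfAlgebra R H]

/-- The map `f` followed by `a ↦ a ⊗ 1`, as an element of the convolution algebra. -/
def convLeft (f : H →ₗ[R] H) : WithConv (H →ₗ[R] H ⊗[R] H) :=
  toConv ((TensorProduct.mk R H H).flip 1 ∘ₗ f)

/-- The map `f` followed by `a ↦ 1 ⊗ a`, as an element of the convolution algebra. -/
def convRight (f : H →ₗ[R] H) : WithConv (H →ₗ[R] H ⊗[R] H) :=
  toConv (TensorProduct.mk R H H 1 ∘ₗ f)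

theorem convLeft_apply (f : H →ₗ[R] H) (a : H) : convLeft f a = f a ⊗ₜ[R] 1 := rfl

theorem convRight_apply (f : H →ₗ[R] H) (a : H) : convRight f a = 1 ⊗ₜ[R] f a := rfl

theorem convLeft_mul_convRight (f g : H →ₗ[R] H) :
    convLeft f * convRight g = toConv (TensorProduct.map f g ∘ₗ comul) := by
  ext a
  simp [(ℛ R a).convMul_apply, convLeft_apply, convRight_apply, ← (ℛ R a).eq]

theorem convRight_mul_convLeft (f g : H →ₗ[R] H) :
    convRight f * convLeft g =
      toConv (TensorProduct.map g f ∘ₗ (TensorProduct.comm R H H).toLinearMap ∘ₗ comul) := by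
  ext a
  simp [(ℛ R a).convMul_apply, convLeft_apply, convRight_apply, ← (ℛ R a).eq]

theorem convLeft_mul (f g : WithConv (H →ₗ[R] H)) :
    convLeft f.ofConv * convLeft g.ofConv = convLeft (f * g).ofConv := by
  ext a
  simp [(ℛ R a).convMul_apply, convLeft_apply, TensorProduct.sum_tmul]

theorem convRight_mul (f g : WithConv (H →ₗ[R] H)) :
    convRight f.ofConv * convRight g.ofConv = convRight (f * g).ofConv := by
  ext a
  simp [(ℛ R a).convMul_apply, convRight_apply, TensorProduct.tmul_sum]

theorem convLeft_one : convLeft (1 : WithConv (H →ₗ[R] H)).ofConv = 1 := by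
  ext a; rfl

theorem convRight_one : convRight (1 : WithConv (H →ₗ[R] H)).ofConv = 1 := by
  ext a
  simp [convRight, Algebra.algebraMap_eq_smul_one, Algebra.TensorProduct.one_def]

/-- With this factorization, convolving with the antipode in one leg cancels that leg of `Δ`. -/
theorem toConv_comul_eq :
    (toConv comul : WithConv (H →ₗ[R] H ⊗[R] H)) = convLeft .id * convRight .id := by
  rw [convLeft_mul_convRight, TensorProduct.map_id, LinearMap.id_comp]

theorem comul_mul_convRight_antipode :
    (toConv comul : WithConv (H →ₗ[R] H ⊗[R] H)) * convRight (antipode R) = convLeft .id := by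
  have := convRight_mul (R := R) (H := H) (toConv .id) (toConv (antipode R))
  rw [LinearMap.id_mul_antipode, convRight_one, ofConv_toConv, ofConv_toConv] at this
  rw [toConv_comul_eq, mul_assoc, this, mul_one]

theorem convLeft_antipode_mul_comul :
    convLeft (antipode R) * (toConv comul : WithConv (H →ₗ[R] H ⊗[R] H)) = convRight .id := by
  have := convLeft_mul (R := R) (H := H) (toConv (antipode R)) (toConv .id)
  rw [LinearMap.antipode_mul_id, convLeft_one, ofConv_toConv, ofConv_toConv] at this
  rw [toConv_comul_eq, ← mul_assoc, this, one_mul]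

/-- The antipode is an antihomomorphism of coalgebras. -/
theorem comul_antipode (a : H) :
    comul (R := R) (antipode R a) =
      TensorProduct.map (antipode R) (antipode R) (TensorProduct.comm R H H (comul a)) := by
  have h : convRight (antipode R) * convLeft (antipode R) *
      (toConv comul : WithConv (H →ₗ[R] H ⊗[R] H)) = 1 := by
    have := convRight_mul (R := R) (H := H) (toConv (antipode R)) (toConv .id)
    rw [LinearMap.antipode_mul_id, convRight_one, ofConv_toConv, ofConv_toConv] at this
    rw [mul_assoc, convLeft_antipode_mul_comul, this]
  -- Both sides are convolution inverses of `Δ`: one on the left, `Δ ∘ S` on the right.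
  have := left_inv_eq_right_inv h LinearMap.comul_right_inv
  rw [convRight_mul_convLeft] at this
  exact (LinearMap.congr_fun (toConv_injective this) a).symm

section Integral

variable {Λ : H}

/-- Write `a ⊗ 1 = ∑ Δ(a₁)(1 ⊗ S a₂)`; then `Δ(Λ) Δ(a₁) = ε(a₁) Δ(Λ)`. -/
theorem comul_mul_tmul_one (hΛ : Λ ∈ rightIntegrals (counit (R := R) (A := H))) (a : H) :
    comul (R := R) Λ * (a ⊗ₜ 1) = comul Λ * (1 ⊗ₜ antipode R a) := by
  have h := congr($(comul_mul_convRight_antipode (R := R) (H := H)) a)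
  rw [(ℛ R a).convMul_apply] at h
  have hc := congr(antipode R $(sum_counit_smul (ℛ R a)))
  rw [map_sum] at hc
  rw [show a ⊗ₜ[R] (1 : H) = _ from h.symm, Finset.mul_sum, ← hc, TensorProduct.tmul_sum,
    Finset.mul_sum]
  refine Finset.sum_congr rfl fun i _ => ?_
  rw [← mul_assoc, ofConv_toConv, ← Bialgebra.comul_mul, hΛ, map_smul, map_smul,
    TensorProduct.tmul_smul, mul_smul_comm, smul_mul_assoc]
  rfl

theorem one_tmul_mul_comul (hΛ : Λ ∈ leftIntegrals (counit (R := R) (A := H))) (a : H) :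
    (1 ⊗ₜ a) * comul (R := R) Λ = (antipode R a ⊗ₜ 1) * comul Λ := by
  have h := congr($(convLeft_antipode_mul_comul (R := R) (H := H)) a)
  rw [(ℛ R a).convMul_apply] at h
  have hc : ∑ i ∈ (ℛ R a).index, counit (R := R) ((ℛ R a).right i) • (ℛ R a).left i = a := by
    have := congr(TensorProduct.rid R H $(sum_tmul_counit_eq (ℛ R a)))
    simpa only [map_sum, TensorProduct.rid_tmul, one_smul] using this
  replace hc := congr(antipode R $hc)
  rw [map_sum] at hc
  rw [show (1 : H) ⊗ₜ[R] a = _ from h.symm, Finset.sum_mul, ← hc, TensorProduct.sum_tmul,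
    Finset.sum_mul]
  refine Finset.sum_congr rfl fun i _ => ?_
  rw [mul_assoc, ofConv_toConv, ← Bialgebra.comul_mul, hΛ, map_smul, map_smul,
    ← TensorProduct.smul_tmul', smul_mul_assoc, mul_smul_comm]
  rfl

/-- Evaluate `Λ * t` in two ways. -/
theorem rightIntegral_eq_smul {t : H} (hΛ : Λ ∈ rightIntegrals (counit (R := R) (A := H)))
    (ht : t ∈ leftIntegrals (counit (R := R) (A := H))) (h1 : counit (R := R) t = 1) :
    Λ = counit (R := R) Λ • t := by
  rw [← ht Λ, hΛ t, h1, one_smul]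

theorem antipode_mem_rightIntegrals (hinv : IsInvolutory R H)
    (hΛ : Λ ∈ leftIntegrals (counit (R := R) (A := H))) :
    antipode R Λ ∈ rightIntegrals (counit (R := R) (A := H)) := fun a => by
  conv_lhs => rw [← hinv a]
  rw [← antipode_mul_antidistrib, hΛ, map_smul, counit_antipode]

theorem sum_smul_apply_eq_of_leftIntegral [Module.Projective R H] {l : Module.Dual R H}
    (hl : toConv l ∈ leftIntegrals (dualCounit R H)) (a : H) :
    TensorProduct.rid R H (LinearMap.lTensor H l (comul a)) = l a • 1 := by
  -- Functionals separate the points of the projective module `H`, and on each functional the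
  -- identity is the integral property of `l`.
  refine (Module.forall_dual_apply_eq_zero_iff R _).mp ?_ |> sub_eq_zero.mp
  intro f
  have h := congr($(hl (toConv f)) a)
  rw [(ℛ R a).convMul_apply] at h
  change _ = f 1 * l a at h
  rw [map_sub, sub_eq_zero, ← (ℛ R a).eq]
  simpa [mul_comm] using h

end Integral

end Hopf

/-! ### Dual bases from a two-sided integral. -/

section HopfDualBases

open Coalgebra HopfAlgebra WithConv

variable {R H : Type*} [CommRing R] [Ring H] [HopfAlgebra R H] {Λ : H}

theorem mem_leftIntegrals_of_isSeparableAlgebra (hsep : IsSeparableAlgebra R H)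
    (hΛ : Λ ∈ rightIntegrals (counit (R := R) (A := H))) :
    Λ ∈ leftIntegrals (counit (R := R) (A := H)) := by
  obtain ⟨t, ht, h1⟩ := hsep.exists_leftIntegral (Bialgebra.counitAlgHom R H)
  rw [rightIntegral_eq_smul hΛ ht h1]
  exact Submodule.smul_mem _ _ ht

theorem isUnit_counit_of_isSeparableAlgebra (hsep : IsSeparableAlgebra R H)
    (hΛ : Λ ∈ rightIntegrals (counit (R := R) (A := H))) {l : Module.Dual R H} (hlΛ : l Λ = 1) :
    IsUnit (counit (R := R) Λ) := by
  obtain ⟨t, ht, h1⟩ := hsep.exists_leftIntegral (Bialgebra.counitAlgHom R H)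
  refine IsUnit.of_mul_eq_one (l t) ?_
  rw [← smul_eq_mul, ← map_smul, ← rightIntegral_eq_smul hΛ ht h1, hlΛ]

theorem antipode_eq_self_of_isSeparableAlgebra (hsep : IsSeparableAlgebra R H)
    (hinv : IsInvolutory R H) (hΛ : Λ ∈ rightIntegrals (counit (R := R) (A := H))) :
    antipode R Λ = Λ := by
  obtain ⟨t, ht, h1⟩ := hsep.exists_leftIntegral (Bialgebra.counitAlgHom R H)
  have ht' : antipode R t = t := by
    have := rightIntegral_eq_smul (antipode_mem_rightIntegrals hinv ht) ht h1
    rwa [counit_antipode, show counit (R := R) t = 1 from h1, one_smul] at this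
  rw [rightIntegral_eq_smul hΛ ht h1, map_smul, ht']

/-- `Δ(Λ) = Δ(S Λ) = S Λ₂ ⊗ S Λ₁`; apply `S ⊗ 1` and use `S² = 1`. -/
theorem comul_symm_of_antipode_eq_self (hinv : IsInvolutory R H) (hS : antipode R Λ = Λ) :
    TensorProduct.comm R H H ((antipode R).rTensor H (comul Λ)) =
      (antipode R).rTensor H (comul Λ) := by
  have hS2 : antipode R ∘ₗ antipode R = (.id : H →ₗ[R] H) := LinearMap.ext hinv
  conv_rhs => rw [← hS, comul_antipode]
  generalize comul (R := R) Λ = w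
  induction w with
  | zero => simp
  | tmul a b => simp [hinv b]
  | add v w hv hw => simp only [map_add, hv, hw]

theorem sum_antipode_smul_eq (hinv : IsInvolutory R H) (hS : antipode R Λ = Λ)
    (f : Module.Dual R H) :
    ∑ i ∈ (ℛ R Λ).index, f (antipode R ((ℛ R Λ).left i)) • (ℛ R Λ).right i =
      ∑ i ∈ (ℛ R Λ).index, f ((ℛ R Λ).right i) • antipode R ((ℛ R Λ).left i) := by
  have h := congr(TensorProduct.rid R H (LinearMap.lTensor H f
    $(comul_symm_of_antipode_eq_self hinv hS)))
  rw [← (ℛ R Λ).eq] at h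
  simpa using h

variable [Module.Projective R H] {l : Module.Dual R H}

/-- Apply `1 ⊗ l` to `Δ(Λ)(S a ⊗ 1) = Δ(Λ)(1 ⊗ a)`: since `∑ l(Λ₂) Λ₁ = 1`, this reads `S a = ∑ l(Λ₂
a) Λ₁`. Then apply `S`. -/
theorem sum_apply_mul_smul_antipode (hinv : IsInvolutory R H)
    (hΛ : Λ ∈ rightIntegrals (counit (R := R) (A := H)))
    (hl : toConv l ∈ leftIntegrals (dualCounit R H)) (hlΛ : l Λ = 1) (a : H) :
    ∑ i ∈ (ℛ R Λ).index, l ((ℛ R Λ).right i * a) • antipode R ((ℛ R Λ).left i) = a := by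
  have h₁ := sum_smul_apply_eq_of_leftIntegral hl Λ
  have h₂ := congr(TensorProduct.rid R H (LinearMap.lTensor H l
    $(comul_mul_tmul_one hΛ (antipode R a))))
  rw [hlΛ, one_smul] at h₁
  rw [hinv] at h₂
  rw [← (ℛ R Λ).eq] at h₁ h₂
  simp only [Finset.sum_mul, map_sum, Algebra.TensorProduct.tmul_mul_tmul, mul_one,
    LinearMap.lTensor_tmul, TensorProduct.rid_tmul] at h₁ h₂
  simp_rw [← smul_mul_assoc] at h₂
  rw [← Finset.sum_mul, h₁, one_mul] at h₂
  simpa [hinv a] using congr(antipode R $h₂.symm)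

theorem sum_apply_mul_smul_antipode' (hinv : IsInvolutory R H)
    (hΛ : Λ ∈ leftIntegrals (counit (R := R) (A := H)))
    (hl : toConv l ∈ leftIntegrals (dualCounit R H)) (hlΛ : l Λ = 1) (a : H) :
    ∑ i ∈ (ℛ R Λ).index, l (a * (ℛ R Λ).right i) • antipode R ((ℛ R Λ).left i) = a := by
  have h₁ := sum_smul_apply_eq_of_leftIntegral hl Λ
  have h₂ := congr(TensorProduct.rid R H (LinearMap.lTensor H l $(one_tmul_mul_comul hΛ a)))
  rw [hlΛ, one_smul] at h₁
  rw [← (ℛ R Λ).eq] at h₁ h₂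
  simp only [Finset.mul_sum, map_sum, Algebra.TensorProduct.tmul_mul_tmul, one_mul,
    LinearMap.lTensor_tmul, TensorProduct.rid_tmul] at h₁ h₂
  simp_rw [← mul_smul_comm] at h₂
  rw [← Finset.mul_sum, h₁, mul_one] at h₂
  simpa [hinv a] using congr(antipode R $h₂)

theorem isDualBasisPair_of_integrals (hinv : IsInvolutory R H) (hS : antipode R Λ = Λ)
    (hr : Λ ∈ rightIntegrals (counit (R := R) (A := H)))
    (hΛ : Λ ∈ leftIntegrals (counit (R := R) (A := H)))
    (hl : toConv l ∈ leftIntegrals (dualCounit R H)) (hlΛ : l Λ = 1) :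
    IsDualBasisPair l (fun i : (ℛ R Λ).index => antipode R ((ℛ R Λ).left i))
      (fun i => (ℛ R Λ).right i) where
  left a := by
    rw [Finset.sum_coe_sort (ℛ R Λ).index
      fun i => l ((ℛ R Λ).right i * a) • antipode R ((ℛ R Λ).left i)]
    exact sum_apply_mul_smul_antipode hinv hr hl hlΛ a
  right a := by
    rw [Finset.sum_coe_sort (ℛ R Λ).index
      fun i => l (a * antipode R ((ℛ R Λ).left i)) • (ℛ R Λ).right i]
    exact (sum_antipode_smul_eq hinv hS (l ∘ₗ LinearMap.mulLeft R a)).trans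
      (sum_apply_mul_smul_antipode' hinv hΛ hl hlΛ a)

/-- Expanding `a` in the `Λ₂` and `b` in the `S Λ₁` turns both sides into `∑ l(S(Λ₁) a) l(Λ₂ b)`. -/
theorem apply_mul_comm_of_integrals (hinv : IsInvolutory R H) (hS : antipode R Λ = Λ)
    (hr : Λ ∈ rightIntegrals (counit (R := R) (A := H)))
    (hl : toConv l ∈ leftIntegrals (dualCounit R H)) (hlΛ : l Λ = 1) (a b : H) :
    l (a * b) = l (b * a) := by
  have h : ∑ i ∈ (ℛ R Λ).index, l (antipode R ((ℛ R Λ).left i) * a) • (ℛ R Λ).right i = a :=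
    (sum_antipode_smul_eq hinv hS (l ∘ₗ LinearMap.mulRight R a)).trans
      (sum_apply_mul_smul_antipode hinv hr hl hlΛ a)
  conv_lhs => rw [← h]
  conv_rhs => rw [← sum_apply_mul_smul_antipode hinv hr hl hlΛ b]
  simp [Finset.sum_mul, mul_comm]

end HopfDualBases

theorem mainTheorem6 {R H M : Type*} [CommRing R] [Ring H] [HopfAlgebra R H]
    [Module.Finite R H] [Module.Projective R H]
    (hsep : IsSeparableAlgebra R H) (hinv : IsInvolutory R H)
    (Λ : H) (hΛ : Λ ∈ rightIntegrals (Coalgebra.counit (R := R) (A := H)))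
    (l : Module.Dual R H) (hl : WithConv.toConv l ∈ leftIntegrals (dualCounit R H))
    (hlΛ : l Λ = 1)
    [AddCommGroup M] [Module R M] [Module H M] [IsScalarTower R H M]
    [Module.Finite R M] [Module.Projective R M]
    (hcyc : ∃ m : M, Submodule.span H {m} = ⊤)
    (φ : Module.End H M ≃ₐ[R] R) :
    -- the form `β(a, b) = ⟨l, a * b⟩` is nonsingular and symmetric, and `z(M)` is central
    ∃ (_ : (formOf l).IsPerfPair) (hz : characterElement M (formOf l) ∈ Subalgebra.center R H),
      (∀ a b : H, formOf l a b = formOf l b a) ∧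
      -- (a)
      IsUnit (hsRank R M) ∧
      -- (b)
      moduleIndex φ (formOf l) hz =
        Coalgebra.counit (R := R) Λ * Ring.inverse (hsRank R M) ∧
      IsUnit (moduleIndex φ (formOf l) hz) ∧
      -- (c)
      IsIdempotentElem (moduleIdempotent φ (formOf l) hz) ∧
      formOf l (moduleIdempotent φ (formOf l) hz : H) =
        Ring.inverse (moduleIndex φ (formOf l) hz) • moduleCharacter R H M ∧
      formOf (regularCharacter R H) (moduleIdempotent φ (formOf l) hz : H) =
        hsRank R M • moduleCharacter R H M := by
  have hΛl := mem_leftIntegrals_of_isSeparableAlgebra hsep hΛ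
  have hS := antipode_eq_self_of_isSeparableAlgebra hsep hinv hΛ
  have hdual := isDualBasisPair_of_integrals hinv hS hΛ hΛl hl hlΛ
  have hsymm := apply_mul_comm_of_integrals hinv hS hΛ hl hlΛ
  have hε := isUnit_counit_of_isSeparableAlgebra hsep hΛ hlΛ
  have hu : ∑ i : (Coalgebra.Repr.arbitrary R Λ).index,
      HopfAlgebra.antipode R ((Coalgebra.Repr.arbitrary R Λ).left i) *
        (Coalgebra.Repr.arbitrary R Λ).right i = Coalgebra.counit (R := R) Λ • 1 := by
    rw [← HopfAlgebra.sum_antipode_mul_eq_smul (Coalgebra.Repr.arbitrary R Λ)]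
    exact Finset.sum_coe_sort (Coalgebra.Repr.arbitrary R Λ).index fun i =>
      HopfAlgebra.antipode R ((Coalgebra.Repr.arbitrary R Λ).left i) *
        (Coalgebra.Repr.arbitrary R Λ).right i
  have hperf := hdual.isPerfPair
  have hz : characterElement M (formOf l) ∈ Subalgebra.center R H :=
    characterElement_mem_center hsymm
  have hmul := moduleIndex_mul_hsRank hdual hsymm φ hz hu
  -- The unit `ε(Λ)` is index times rank, so both factors are units.
  rw [← hmul] at hε
  have hi := isUnit_of_mul_isUnit_left hε
  have hr := isUnit_of_mul_isUnit_right hε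
  have hform := formOf_moduleIdempotent hsymm φ hz
  refine ⟨hperf, hz, hsymm, hr, ?_, hi, isIdempotentElem_moduleIdempotent φ hz hi, hform, ?_⟩
  · rw [← hmul, mul_assoc, Ring.mul_inverse_cancel _ hr, mul_one]
  · have hreg : formOf (regularCharacter R H) = Coalgebra.counit (R := R) Λ • formOf l := by
      rw [hdual.regularCharacter_eq hsymm hu]
      rfl
    rw [hreg, LinearMap.smul_apply, hform, ← hmul, smul_smul, mul_right_comm,
      Ring.mul_inverse_cancel _ hi, one_mul]
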